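/- Let $q$ be an even prime power, i.e. $q=2^k$ with $k\ge 1$, and let $Sp(2n,q)$ be the group of $2n\times 2n$ matrices over the field with $q$ elements that preserve the standard nondegenerate alternating form on $\mathbb{F}_q^{2n}$. Let $i_{Sp}(2n,q)$ be the number of involutions in $Sp(2n,q)$, that is, the number of $g\in Sp(2n,q)$ with $g^2=1$ (the identity is counted). Then, for fixed $q$, the infinite product below converges and $$\lim_{n\to\infty}\frac{i_{Sp}(2n,q)}{q^{n^2+n}}=\prod_{i\ge 1}\left(1+\frac{1}{q^{2i}}\right).$$ -/

import Mathlib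

/-- The number `i_Sp(2n, q)` of involutions in the symplectic group `Sp(2n, F)`, `F` having `q`
elements. An involution is an element `g` with `g ^ 2 = 1`; the identity is counted. -/
noncomputable def symplecticInvolutionCount (n : ℕ) (F : Type*) [Field F] : ℕ :=
  Nat.card {g : Matrix.symplecticGroup (Fin n) F // g ^ 2 = 1}

/-! In characteristic two, `g = 1 + N` is a symplectic involution exactly when `N ^ 2 = 0` and `N`
is self-adjoint for the form `B`. So the task is to count such `N` on a space `V` of dimension `2n`.
Put `Q = q ^ 2`, so that `|V| = Q ^ n`.

For such an `N` the map `x ↦ B x (N x)` is additive and Frobenius-semilinear, hence zero (`N`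
alternating) or onto. Count pairs `(N, v)` with `B v (N v) ≠ 0`. The value `w = N v` fixes `N` on
the hyperbolic plane spanned by `v, w` and leaves it free on the orthogonal complement. With `a n`
the total and `A n` the alternating count, this gives `a n = (Q ^ n - 1) * a (n - 1) + A n`
(`sqZeroCount_eq`).

If `N` is alternating and `N v ≠ 0`, the vectors `v, N v` and a suitable `v', N v'` span a
nondegenerate 4-space that splits off and carries rank 2. The resulting recursion
(`altRankSum_mul_eq`) determines the rank distribution: rank `2k` occurs `qFact Q n * u k * v (n -
2k)` times, with `u k = Q⁻ᵏ / qPoch (1/Q) k` and `v j = 1 / qFact Q j`.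

Hence `a n / qFact Q n` is the sum of `u k * v j` over `2k + j ≤ n`, which tends to `(∑ u) * (∑ v)`.
Since `qFact Q n = q ^ (n ^ 2 + n) * qPoch (1/Q) n` and `1 / qPoch (1/Q) n` is a partial sum of `∑
u`, the factor `∑ u` cancels. The limit `∑ v` is the product by Euler's identity. -/

open LinearMap (BilinForm range mem_range_self)
open Module (End finrank)

/-- A symmetric, alternating and nondegenerate bilinear form, that is, a symplectic form in
characteristic two. -/
structure IsSymplecticForm {F V : Type*} [Field F] [AddCommGroup V] [Module F V]
    (B : BilinForm F V) : Prop where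
  alt : ∀ x, B x x = 0
  symm : ∀ x y, B x y = B y x
  nondeg : ∀ x, (∀ y, B x y = 0) → x = 0

/-- A self-adjoint endomorphism of square zero. -/
structure IsSqZeroSelfAdjoint {F V : Type*} [Field F] [AddCommGroup V] [Module F V]
    (B : BilinForm F V) (N : End F V) : Prop where
  sq_zero : ∀ x, N (N x) = 0
  adjoint : ∀ x y, B (N x) y = B x (N y)

/-- An endomorphism `N` is alternating if the form `B x (N y)` is alternating. -/
def IsAlternatingEnd {F V : Type*} [Field F] [AddCommGroup V] [Module F V]
    (B : BilinForm F V) (N : End F V) : Prop :=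
  ∀ x, B x (N x) = 0

/-! ### Extending endomorphisms from an orthogonal complement -/

section Splitting

variable {F V : Type*} [Field F] [AddCommGroup V] [Module F V] {B : BilinForm F V}
  {U : Submodule F V}

theorem IsSymplecticForm.isRefl (hB : IsSymplecticForm B) : B.IsRefl := fun x y h => by
  rw [hB.symm, h]

theorem IsSymplecticForm.nondegenerate (hB : IsSymplecticForm B) : B.Nondegenerate :=
  ⟨hB.nondeg, fun y h => hB.nondeg y fun x => by rw [hB.symm, h]⟩

theorem IsSymplecticForm.restrict_orthogonal (hB : IsSymplecticForm B)
    (hU : IsCompl U (B.orthogonal U)) : IsSymplecticForm (B.restrict (B.orthogonal U)) where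
  alt x := hB.alt x
  symm x y := hB.symm x y
  nondeg x hx := by
    have : (x : V) = 0 := hB.nondeg x fun y => by
      obtain ⟨u, hu, w, hw, rfl⟩ := Submodule.mem_sup.1
        (show y ∈ U ⊔ B.orthogonal U from hU.sup_eq_top ▸ Submodule.mem_top)
      rw [map_add, hB.symm _ u, x.2 u hu, zero_add]
      exact hx ⟨w, hw⟩
    exact_mod_cast this

/-- The sum of `N₀` and the extension by zero of an endomorphism of the orthogonal complement. -/
noncomputable def extendEnd (hU : IsCompl U (B.orthogonal U)) (N₀ : End F V)
    (M : End F (B.orthogonal U)) : End F V :=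
  N₀ + (B.orthogonal U).subtype ∘ₗ M ∘ₗ (B.orthogonal U).projectionOnto U hU.symm

theorem extendEnd_apply_left (hU : IsCompl U (B.orthogonal U)) (N₀ : End F V)
    (M : End F (B.orthogonal U)) {u : V} (hu : u ∈ U) : extendEnd hU N₀ M u = N₀ u := by
  have : (B.orthogonal U).projectionOnto U hU.symm u = 0 := by
    simpa using hu
  simp [extendEnd, this]

theorem extendEnd_apply_right (hU : IsCompl U (B.orthogonal U)) {N₀ : End F V}
    (h₀ : ∀ w ∈ B.orthogonal U, N₀ w = 0)
    (M : End F (B.orthogonal U)) (w : B.orthogonal U) : extendEnd hU N₀ M w = M w := by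
  simp [extendEnd, h₀ w w.2]

theorem exists_add_of_isCompl (hU : IsCompl U (B.orthogonal U)) (x : V) :
    ∃ u ∈ U, ∃ w : B.orthogonal U, x = u + w := by
  obtain ⟨u, hu, w, hw, rfl⟩ := Submodule.mem_sup.1
    (show x ∈ U ⊔ B.orthogonal U from hU.sup_eq_top ▸ Submodule.mem_top)
  exact ⟨u, hu, ⟨w, hw⟩, rfl⟩

theorem extendEnd_apply_add (hU : IsCompl U (B.orthogonal U)) {N₀ : End F V}
    (h₀ : ∀ w ∈ B.orthogonal U, N₀ w = 0)
    (M : End F (B.orthogonal U)) {u : V} (hu : u ∈ U) (w : B.orthogonal U) :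
    extendEnd hU N₀ M (u + w) = N₀ u + M w := by
  rw [map_add, extendEnd_apply_left hU N₀ M hu, extendEnd_apply_right hU h₀]

theorem isSqZeroSelfAdjoint_extendEnd (hB : IsSymplecticForm B)
    (hU : IsCompl U (B.orthogonal U)) {N₀ : End F V} (hN₀ : IsSqZeroSelfAdjoint B N₀)
    (hr : ∀ x, N₀ x ∈ U) (h₀ : ∀ w ∈ B.orthogonal U, N₀ w = 0)
    {M : End F (B.orthogonal U)} (hM : IsSqZeroSelfAdjoint (B.restrict (B.orthogonal U)) M) :
    IsSqZeroSelfAdjoint B (extendEnd hU N₀ M) where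
  sq_zero x := by
    obtain ⟨u, hu, w, rfl⟩ := exists_add_of_isCompl hU x
    rw [extendEnd_apply_add hU h₀ M hu, extendEnd_apply_add hU h₀ M (hr u), hN₀.sq_zero,
      hM.sq_zero]
    simp
  adjoint x y := by
    obtain ⟨u, hu, w, rfl⟩ := exists_add_of_isCompl hU x
    obtain ⟨u', hu', w', rfl⟩ := exists_add_of_isCompl hU y
    rw [extendEnd_apply_add hU h₀ M hu, extendEnd_apply_add hU h₀ M hu']
    have e1 : B (N₀ u) w' = 0 := w'.2 _ (hr u)
    have e2 : B (M w) u' = 0 := by rw [hB.symm]; exact (M w).2 _ hu'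
    have e3 : B w (N₀ u') = 0 := by rw [hB.symm]; exact w.2 _ (hr u')
    have e4 : B u (M w') = 0 := (M w').2 _ hu
    have e5 : B (M w) w' = B w (M w') := hM.adjoint w w'
    simp only [map_add, LinearMap.add_apply, e1, e2, e3, e4, e5, hN₀.adjoint]

theorem isAlternatingEnd_extendEnd_iff (hB : IsSymplecticForm B)
    (hU : IsCompl U (B.orthogonal U)) {N₀ : End F V} (hN₀ : IsAlternatingEnd B N₀)
    (hr : ∀ x, N₀ x ∈ U) (h₀ : ∀ w ∈ B.orthogonal U, N₀ w = 0)
    {M : End F (B.orthogonal U)} :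
    IsAlternatingEnd B (extendEnd hU N₀ M) ↔
      IsAlternatingEnd (B.restrict (B.orthogonal U)) M := by
  have key : ∀ u ∈ U, ∀ w : B.orthogonal U,
      B (u + w) (extendEnd hU N₀ M (u + w)) = B w (M w) := fun u hu w => by
    rw [extendEnd_apply_add hU h₀ M hu]
    have e3 : B w (N₀ u) = 0 := by rw [hB.symm]; exact w.2 _ (hr u)
    have e4 : B u (M w) = 0 := (M w).2 _ hu
    simp only [map_add, LinearMap.add_apply, e3, e4, hN₀ u]
    ring
  constructor
  · intro h w
    have := key 0 (zero_mem _) w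
    rw [h] at this
    exact this.symm
  · intro h x
    obtain ⟨u, hu, w, rfl⟩ := exists_add_of_isCompl hU x
    rw [key u hu]
    exact h w

/-- An `N` that agrees with `N₀` on `U` maps `U` into `U`; by self-adjointness it also preserves the
orthogonal complement, so its restriction there is the only remaining datum. -/
theorem bijOn_extendEnd (hB : IsSymplecticForm B)
    (hU : IsCompl U (B.orthogonal U)) {N₀ : End F V} (hN₀ : IsSqZeroSelfAdjoint B N₀)
    (hr : ∀ x, N₀ x ∈ U) (h₀ : ∀ w ∈ B.orthogonal U, N₀ w = 0) :
    Set.BijOn (extendEnd hU N₀) {M | IsSqZeroSelfAdjoint (B.restrict (B.orthogonal U)) M}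
      {N | IsSqZeroSelfAdjoint B N ∧ ∀ u ∈ U, N u = N₀ u} := by
  refine ⟨fun M hM => ⟨isSqZeroSelfAdjoint_extendEnd hB hU hN₀ hr h₀ hM,
    fun u hu => extendEnd_apply_left hU N₀ M hu⟩, fun M _ M' _ h => ?_, fun N ⟨hN, hNU⟩ => ?_⟩
  · ext w
    rw [← extendEnd_apply_right hU h₀ M, ← extendEnd_apply_right hU h₀ M', h]
  · have hW : ∀ w ∈ B.orthogonal U, N w ∈ B.orthogonal U := fun w hw u hu => by
      change B u (N w) = 0
      rw [← hN.adjoint, hNU u hu]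
      exact hw _ (hr u)
    have hext : extendEnd hU N₀ (N.restrict hW) = N := by
      ext x
      obtain ⟨u, hu, w, rfl⟩ := exists_add_of_isCompl hU x
      rw [extendEnd_apply_add hU h₀ _ hu, map_add, hNU u hu]
      rfl
    refine ⟨N.restrict hW, ⟨fun w => ?_, fun w w' => hN.adjoint w w'⟩, hext⟩
    ext
    exact hN.sq_zero w

theorem bijOn_extendEnd_alternating (hB : IsSymplecticForm B)
    (hU : IsCompl U (B.orthogonal U)) {N₀ : End F V} (hN₀ : IsSqZeroSelfAdjoint B N₀)
    (ha : IsAlternatingEnd B N₀)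
    (hr : ∀ x, N₀ x ∈ U) (h₀ : ∀ w ∈ B.orthogonal U, N₀ w = 0) :
    Set.BijOn (extendEnd hU N₀)
      {M | IsSqZeroSelfAdjoint (B.restrict (B.orthogonal U)) M ∧
        IsAlternatingEnd (B.restrict (B.orthogonal U)) M}
      {N | (IsSqZeroSelfAdjoint B N ∧ IsAlternatingEnd B N) ∧ ∀ u ∈ U, N u = N₀ u} := by
  have h := bijOn_extendEnd hB hU hN₀ hr h₀
  have hiff (M) := isAlternatingEnd_extendEnd_iff hB hU ha hr h₀ (M := M)
  refine ⟨fun M hM => ⟨⟨(h.mapsTo hM.1).1, (hiff M).2 hM.2⟩, (h.mapsTo hM.1).2⟩,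
    h.injOn.mono fun M hM => hM.1, fun N hN => ?_⟩
  obtain ⟨M, hM, rfl⟩ := h.surjOn ⟨hN.1.1, hN.2⟩
  exact ⟨M, ⟨hM, (hiff M).1 hN.1.2⟩, rfl⟩

theorem finrank_range_extendEnd [FiniteDimensional F V]
    (hU : IsCompl U (B.orthogonal U)) {N₀ : End F V}
    (hr : ∀ x, N₀ x ∈ U) (h₀ : ∀ w ∈ B.orthogonal U, N₀ w = 0) (M : End F (B.orthogonal U)) :
    finrank F (range (extendEnd hU N₀ M)) = finrank F (range N₀) + finrank F (range M) := by
  have hM : finrank F ((range M).map (B.orthogonal U).subtype) = finrank F (range M) :=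
    Submodule.finrank_map_subtype_eq _ _
  have hrange : range (extendEnd hU N₀ M) =
      range N₀ ⊔ (range M).map (B.orthogonal U).subtype := by
    apply le_antisymm
    · rintro _ ⟨x, rfl⟩
      obtain ⟨u, hu, w, rfl⟩ := exists_add_of_isCompl hU x
      rw [extendEnd_apply_add hU h₀ M hu]
      exact Submodule.add_mem_sup (mem_range_self _ _)
        (Submodule.mem_map_of_mem (mem_range_self _ _))
    · refine sup_le ?_ ?_
      · rintro _ ⟨x, rfl⟩
        obtain ⟨u, hu, w, rfl⟩ := exists_add_of_isCompl hU x
        refine ⟨u, ?_⟩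
        rw [extendEnd_apply_left hU N₀ M hu, map_add, h₀ w w.2, add_zero]
      · rintro _ ⟨_, ⟨w, rfl⟩, rfl⟩
        exact ⟨w, extendEnd_apply_right hU h₀ M w⟩
  have hdisj : Disjoint (range N₀) ((range M).map (B.orthogonal U).subtype) := by
    refine hU.disjoint.mono ?_ (Submodule.map_subtype_le _ _)
    rintro _ ⟨x, rfl⟩
    exact hr x
  have := Submodule.finrank_sup_add_finrank_inf_eq (range N₀)
    ((range M).map (B.orthogonal U).subtype)
  rw [hdisj.eq_bot, finrank_bot, add_zero] at this
  rw [hrange, this, hM]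

end Splitting

/-! ### Splitting off nondegenerate subspaces of dimension 2 and 4 -/

section Configurations

variable {F V : Type*} [Field F] [AddCommGroup V] [Module F V]
  {B : BilinForm F V}

/-- The hypothesis says that the Gram matrix of `u` has trivial kernel. It also makes the span
nondegenerate, as used in `isCompl_orthogonal_span_range`. -/
theorem linearIndependent_of_forall_eq_zero {k : ℕ} {u : Fin k → V}
    (hu : ∀ a : Fin k → F, (∀ j, B (u j) (∑ i, a i • u i) = 0) → ∀ i, a i = 0) :
    LinearIndependent F u :=
  Fintype.linearIndependent_iff.2 fun a ha => hu a fun j => by rw [ha, map_zero]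

theorem forall_mem_span_range_eq_iff {k : ℕ} {u : Fin k → V} {N N₀ : End F V} :
    (∀ x ∈ Submodule.span F (Set.range u), N x = N₀ x) ↔ ∀ i, N (u i) = N₀ (u i) := by
  refine ⟨fun h i => h _ (Submodule.subset_span ⟨i, rfl⟩), fun h => ?_⟩
  apply LinearMap.eqOn_span
  rintro _ ⟨i, rfl⟩
  exact h i

/-- The number of self-adjoint endomorphisms of square zero. -/
noncomputable def sqZeroCount (B : BilinForm F V) : ℕ :=
  {N : End F V | IsSqZeroSelfAdjoint B N}.ncard

/-- The sum of `f (rank N)` over the alternating self-adjoint endomorphisms `N` of square zero. -/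
noncomputable def altRankSum (B : BilinForm F V) (f : ℕ → ℝ) : ℝ :=
  ∑ᶠ N ∈ {N : End F V | IsSqZeroSelfAdjoint B N ∧ IsAlternatingEnd B N}, f (finrank F (range N))

variable [FiniteDimensional F V]

theorem isCompl_orthogonal_span_range (hB : IsSymplecticForm B) {k : ℕ} {u : Fin k → V}
    (hu : ∀ a : Fin k → F, (∀ j, B (u j) (∑ i, a i • u i) = 0) → ∀ i, a i = 0) :
    IsCompl (Submodule.span F (Set.range u)) (B.orthogonal (Submodule.span F (Set.range u))) := by
  rw [LinearMap.BilinForm.isCompl_orthogonal_iff_disjoint hB.isRefl, Submodule.disjoint_def]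
  intro x hx hx'
  obtain ⟨a, rfl⟩ := (Submodule.mem_span_range_iff_exists_fun F).1 hx
  have := hu a fun j => hx' _ (Submodule.subset_span ⟨j, rfl⟩)
  simp [this]

theorem finrank_orthogonal_span_range (hB : IsSymplecticForm B) {k : ℕ} {u : Fin k → V}
    (hu : LinearIndependent F u) :
    finrank F V = finrank F (B.orthogonal (Submodule.span F (Set.range u))) + k := by
  have h1 := finrank_span_eq_card hu
  have h2 := LinearMap.BilinForm.finrank_orthogonal hB.nondegenerate
    (Submodule.span F (Set.range u))
  have h3 := Submodule.finrank_le (Submodule.span F (Set.range u))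
  rw [Fintype.card_fin] at h1
  omega

/-- `N v = w` forces `N w = 0`, so `N` is prescribed on the hyperbolic plane spanned by `v, w`,
where it agrees with the rank-one map `N₀`. -/
theorem exists_ncard_eq_sqZeroCount (hB : IsSymplecticForm B) {v w : V}
    (hvw : B v w ≠ 0) :
    ∃ W : Submodule F V, finrank F V = finrank F W + 2 ∧ IsSymplecticForm (B.restrict W) ∧
      {N | IsSqZeroSelfAdjoint B N ∧ N v = w}.ncard = sqZeroCount (B.restrict W) := by
  let u : Fin 2 → V := ![v, w]
  have hwv : B w v ≠ 0 := by rwa [hB.symm]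
  have hu : ∀ a : Fin 2 → F, (∀ j, B (u j) (∑ i, a i • u i) = 0) → ∀ i, a i = 0 := by
    intro a ha
    have h0 := ha 0
    have h1 := ha 1
    simp [u, Fin.sum_univ_two, hB.alt, hvw, hwv] at h0 h1
    simp [Fin.forall_fin_two, h0, h1]
  have hU := isCompl_orthogonal_span_range hB hu
  let N₀ : End F V := (B v w)⁻¹ • (B.flip w).smulRight w
  have hN₀ (x) : N₀ x = (B v w)⁻¹ • B x w • w := by simp [N₀]
  have hw : w ∈ Submodule.span F (Set.range u) := Submodule.subset_span ⟨1, rfl⟩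
  have hr (x) : N₀ x ∈ Submodule.span F (Set.range u) := by
    rw [hN₀]
    exact Submodule.smul_mem _ _ (Submodule.smul_mem _ _ hw)
  have h₀ : ∀ x ∈ B.orthogonal (Submodule.span F (Set.range u)), N₀ x = 0 := fun x hx => by
    have : B w x = 0 := hx w hw
    rw [hN₀, hB.symm x, this, zero_smul, smul_zero]
  have hsq : IsSqZeroSelfAdjoint B N₀ := by
    refine ⟨fun x => ?_, fun x y => ?_⟩
    · simp [hN₀, hB.alt]
    · simp only [hN₀, map_smul, LinearMap.smul_apply, smul_eq_mul, hB.symm w y]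
      ring
  have hbij := bijOn_extendEnd hB hU hsq hr h₀
  refine ⟨_, finrank_orthogonal_span_range hB (linearIndependent_of_forall_eq_zero hu),
    hB.restrict_orthogonal hU, ?_⟩
  have hset : {N | IsSqZeroSelfAdjoint B N ∧ N v = w} = {N | IsSqZeroSelfAdjoint B N ∧
      ∀ x ∈ Submodule.span F (Set.range u), N x = N₀ x} := by
    ext N
    simp only [Set.mem_ofPred_eq, forall_mem_span_range_eq_iff, Fin.forall_fin_two]
    refine and_congr_right fun hN => ?_
    have e0 : N₀ v = w := by rw [hN₀, smul_smul, inv_mul_cancel₀ hvw, one_smul]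
    have e1 : N₀ w = 0 := by rw [hN₀, hB.alt, zero_smul, smul_zero]
    change N v = w ↔ N v = N₀ v ∧ N w = N₀ w
    rw [e0, e1]
    exact ⟨fun h => ⟨h, by rw [← h, hN.sq_zero]⟩, fun h => h.1⟩
  rw [hset, ← hbij.image_eq, hbij.injOn.ncard_image]
  rfl

/-- The hypotheses are the relations that an alternating `N` imposes on `w = N v` and `w' = N v'`,
together with `B v' w ≠ 0`, which makes the span of the four vectors nondegenerate. Since `N` kills
`w` and `w'`, it is prescribed on that span, with rank 2. -/
theorem exists_finsum_eq_altRankSum [CharP F 2] (hB : IsSymplecticForm B) {v w v' w' : V}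
    (hvw : B v w = 0) (hv'w : B v' w ≠ 0) (hvw' : B v w' = B v' w) (hv'w' : B v' w' = 0)
    (hww' : B w w' = 0) :
    ∃ W : Submodule F V, finrank F V = finrank F W + 4 ∧ IsSymplecticForm (B.restrict W) ∧
      ∀ f : ℕ → ℝ, ∑ᶠ N ∈ {N | (IsSqZeroSelfAdjoint B N ∧ IsAlternatingEnd B N) ∧
        N v = w ∧ N v' = w'}, f (finrank F (range N)) =
        altRankSum (B.restrict W) (fun r => f (2 + r)) := by
  -- The span of `w, w'` is totally isotropic: pairing with these two kills the coefficients of `v,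
  -- v'`, after which pairing with `v, v'` kills the others.
  let u : Fin 4 → V := ![w, w', v, v']
  set c := B v' w with hc
  have hwv : B w v = 0 := by rwa [hB.symm]
  have hwv' : B w v' = c := by rw [hB.symm]
  have hw'v : B w' v = c := by rwa [hB.symm]
  have hw'v' : B w' v' = 0 := by rwa [hB.symm]
  have hw'w : B w' w = 0 := by rwa [hB.symm]
  have hu : ∀ a : Fin 4 → F, (∀ j, B (u j) (∑ i, a i • u i) = 0) → ∀ i, a i = 0 := by
    intro a ha
    have h0 := ha 0
    have h1 := ha 1
    have h2 := ha 2
    have h3 := ha 3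
    simp [u, Fin.sum_univ_four, hB.alt, hvw, ← hc, hvw', hv'w', hww', hwv, hwv', hw'v, hw'v', hw'w,
      hv'w] at h0 h1 h2 h3
    simp [h0, h1, hv'w] at h2 h3
    simp [Fin.forall_fin_succ, h0, h1, h2, h3]
  have hU := isCompl_orthogonal_span_range hB hu
  let N₀ : End F V := c⁻¹ • ((B.flip w').smulRight w + (B.flip w).smulRight w')
  have hN₀ (x) : N₀ x = c⁻¹ • (B x w' • w + B x w • w') := by simp [N₀]
  have hw : w ∈ Submodule.span F (Set.range u) := Submodule.subset_span ⟨0, rfl⟩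
  have hw' : w' ∈ Submodule.span F (Set.range u) := Submodule.subset_span ⟨1, rfl⟩
  have hr (x) : N₀ x ∈ Submodule.span F (Set.range u) := by
    rw [hN₀]
    exact Submodule.smul_mem _ _ (add_mem (Submodule.smul_mem _ _ hw) (Submodule.smul_mem _ _ hw'))
  have h₀ : ∀ x ∈ B.orthogonal (Submodule.span F (Set.range u)), N₀ x = 0 := fun x hx => by
    have e1 : B w x = 0 := hx w hw
    have e2 : B w' x = 0 := hx w' hw'
    rw [hN₀, hB.symm x, hB.symm x, e1, e2, zero_smul, zero_smul, add_zero, smul_zero]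
  have hsq : IsSqZeroSelfAdjoint B N₀ := by
    refine ⟨fun x => ?_, fun x y => ?_⟩
    · simp [hN₀, hB.alt, hww', hw'w]
    · simp only [hN₀, map_smul, LinearMap.smul_apply, smul_eq_mul, map_add, LinearMap.add_apply,
        hB.symm w y, hB.symm w' y]
      ring
  have halt : IsAlternatingEnd B N₀ := fun x => by
    have : B x w' * B x w + B x w * B x w' = 0 := by
      rw [mul_comm, CharTwo.add_self_eq_zero]
    simp only [hN₀, map_smul, smul_eq_mul, map_add, this, mul_zero]
  have e0 : N₀ v = w := by simp [hN₀, hvw', hvw, hv'w]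
  have e1 : N₀ v' = w' := by simp [hN₀, hv'w', ← hc, hv'w]
  have e2 : N₀ w = 0 := by simp [hN₀, hB.alt, hww']
  have e3 : N₀ w' = 0 := by simp [hN₀, hB.alt, hw'w]
  have hrank : finrank F (range N₀) = 2 := by
    have hind : LinearIndependent F ![w, w'] := by
      rw [LinearIndependent.pair_iff]
      intro s t hst
      have h1 := congrArg (B v) hst
      have h2 := congrArg (B v') hst
      simp [hvw, hvw', hv'w', ← hc, hv'w] at h1 h2
      exact ⟨h2, h1⟩
    have : range N₀ = Submodule.span F (Set.range ![w, w']) := by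
      apply le_antisymm
      · rintro _ ⟨x, rfl⟩
        rw [hN₀]
        exact Submodule.smul_mem _ _ (add_mem
          (Submodule.smul_mem _ _ (Submodule.subset_span ⟨0, rfl⟩))
          (Submodule.smul_mem _ _ (Submodule.subset_span ⟨1, rfl⟩)))
      · rw [Submodule.span_le]
        rintro _ ⟨i, rfl⟩
        fin_cases i
        · exact ⟨v, e0⟩
        · exact ⟨v', e1⟩
    rw [this, finrank_span_eq_card hind, Fintype.card_fin]
  have hbij := bijOn_extendEnd_alternating hB hU hsq halt hr h₀
  refine ⟨_, finrank_orthogonal_span_range hB (linearIndependent_of_forall_eq_zero hu),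
    hB.restrict_orthogonal hU, fun f => ?_⟩
  have hset : {N | (IsSqZeroSelfAdjoint B N ∧ IsAlternatingEnd B N) ∧ N v = w ∧ N v' = w'} =
      {N | (IsSqZeroSelfAdjoint B N ∧ IsAlternatingEnd B N) ∧
        ∀ x ∈ Submodule.span F (Set.range u), N x = N₀ x} := by
    ext N
    simp only [Set.mem_ofPred_eq, forall_mem_span_range_eq_iff, Fin.forall_fin_succ]
    refine and_congr_right fun hN => ?_
    change N v = w ∧ N v' = w' ↔ N w = N₀ w ∧ N w' = N₀ w' ∧ N v = N₀ v ∧ N v' = N₀ v' ∧ _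
    rw [e0, e1, e2, e3]
    refine ⟨fun h => ⟨by rw [← h.1, hN.1.sq_zero], by rw [← h.2, hN.1.sq_zero], h.1, h.2,
      fun i => i.elim0⟩, fun h => ⟨h.2.2.1, h.2.2.2.1⟩⟩
  rw [hset, altRankSum]
  refine (finsum_mem_eq_of_bijOn _ hbij fun M _ => ?_).symm
  rw [finrank_range_extendEnd hU hr h₀, hrank]

end Configurations

/-! ### Double counting with constant fibres -/

section Fibers

theorem finsum_mem_fiberwise {α β : Type*} [Finite α] {P : Set α} {t : Set β} {p : α → β}
    (hp : Set.MapsTo p P t) [Finite β] (g : α → ℝ) :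
    ∑ᶠ b ∈ t, ∑ᶠ a ∈ {a | a ∈ P ∧ p a = b}, g a = ∑ᶠ a ∈ P, g a := by
  classical
  have := Fintype.ofFinite α
  have := Fintype.ofFinite β
  have h1 : ∀ b, ∑ᶠ a ∈ {a | a ∈ P ∧ p a = b}, g a = ∑ a ∈ P.toFinset with p a = b, g a :=
    fun b => by
      rw [← finsum_mem_coe_finset]
      refine finsum_mem_congr (by ext; simp) fun _ _ => rfl
  have h2 : ∑ᶠ a ∈ P, g a = ∑ a ∈ P.toFinset, g a := by
    rw [← finsum_mem_coe_finset, Set.coe_toFinset]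
  have h3 (G : β → ℝ) : ∑ᶠ b ∈ t, G b = ∑ b ∈ t.toFinset, G b := by
    rw [← finsum_mem_coe_finset, Set.coe_toFinset]
  rw [h2, h3]
  simp only [h1]
  exact Finset.sum_fiberwise_of_maps_to (fun a ha => by simpa using hp (by simpa using ha)) g

theorem finsum_mem_const_eq_ncard_mul {β : Type*} [Finite β] (t : Set β) (s : ℝ) :
    ∑ᶠ _b ∈ t, s = t.ncard * s := by
  classical
  have := Fintype.ofFinite β
  rw [← Set.coe_toFinset t, finsum_mem_coe_finset, Finset.sum_const, Set.ncard_coe_finset,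
    nsmul_eq_mul]

theorem finsum_mem_eq_ncard_mul {α β : Type*} [Finite α] {P : Set α} {t : Set β} {p : α → β}
    (hp : Set.MapsTo p P t) [Finite β] {g : α → ℝ} {s : ℝ}
    (hs : ∀ b ∈ t, ∑ᶠ a ∈ {a | a ∈ P ∧ p a = b}, g a = s) :
    ∑ᶠ a ∈ P, g a = t.ncard * s := by
  rw [← finsum_mem_fiberwise hp, finsum_mem_congr rfl hs, finsum_mem_const_eq_ncard_mul]

theorem ncard_eq_ncard_mul {α β : Type*} [Finite α] {P : Set α} {t : Set β} {p : α → β}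
    (hp : Set.MapsTo p P t) [Finite β] {s : ℝ}
    (hs : ∀ b ∈ t, ({a | a ∈ P ∧ p a = b}.ncard : ℝ) = s) :
    (P.ncard : ℝ) = t.ncard * s := by
  rw [← finsum_mem_eq_ncard_mul hp (g := fun _ => 1) fun b hb => ?_, finsum_mem_const_eq_ncard_mul,
    mul_one]
  rw [finsum_mem_const_eq_ncard_mul, mul_one, hs b hb]

theorem AddMonoidHom.ncard_fiber {G A : Type*} [AddCommGroup G] [AddCommGroup A] [Finite G]
    [Finite A] (φ : G →+ A) (hφ : Function.Surjective φ) (a : A) :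
    ({x | φ x = a}.ncard : ℝ) = Nat.card G / Nat.card A := by
  have key : ∀ b, {x | φ x = b}.ncard = {x | φ x = a}.ncard := fun b => by
    obtain ⟨y, hy⟩ := hφ (b - a)
    rw [← Set.ncard_image_of_injective {x | φ x = a} (add_right_injective y)]
    congr 1
    ext x
    constructor
    · intro hx
      have hx : φ x = b := hx
      exact ⟨x - y, by simp [hx, hy], by simp⟩
    · rintro ⟨z, hz, rfl⟩
      have hz : φ z = a := hz
      simp [hz, hy]
  have h := ncard_eq_ncard_mul (P := Set.univ) (t := Set.univ) (p := φ) (Set.mapsTo_univ _ _)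
    (s := {x | φ x = a}.ncard) fun b _ => by rw [← key b]; simp
  rw [Set.ncard_univ, Set.ncard_univ] at h
  have : (Nat.card A : ℝ) ≠ 0 := Nat.cast_ne_zero.2 Nat.card_pos.ne'
  field_simp
  rw [h, mul_comm]

theorem AddMonoidHom.ncard_ne_zero {G A : Type*} [AddCommGroup G] [AddCommGroup A] [Finite G]
    [Finite A] (φ : G →+ A) (hφ : Function.Surjective φ) :
    ({x | φ x ≠ 0}.ncard : ℝ) = Nat.card G - Nat.card G / Nat.card A := by
  rw [← φ.ncard_fiber hφ 0, eq_sub_iff_add_eq', ← Set.ncard_add_ncard_compl {x | φ x = 0}]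
  push_cast
  rfl

end Fibers

/-! ### Counting vectors and the two recursions -/

section Counting

variable {F V : Type*} [Field F] [AddCommGroup V] [Module F V] [Finite F] [Finite V]
  {B : BilinForm F V}

theorem ncard_forall_apply_eq (hB : IsSymplecticForm B) {k : ℕ} {u : Fin k → V}
    (hu : LinearIndependent F u) (c : Fin k → F) :
    ({x | ∀ i, B (u i) x = c i}.ncard : ℝ) = Nat.card V / (Nat.card F : ℝ) ^ k := by
  let φ : V →ₗ[F] (Fin k → F) := LinearMap.pi fun i => B (u i)
  have hker : LinearMap.ker φ = B.orthogonal (Submodule.span F (Set.range u)) := by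
    ext x
    rw [LinearMap.mem_ker, funext_iff]
    constructor
    · intro h y hy
      change B.flip x y = 0
      induction hy using Submodule.span_induction with
      | mem y hy => obtain ⟨i, rfl⟩ := hy; exact h i
      | zero => simp
      | add y z _ _ hy hz => rw [map_add, hy, hz, add_zero]
      | smul a y _ hy => rw [map_smul, hy, smul_zero]
    · exact fun h i => h _ (Submodule.subset_span ⟨i, rfl⟩)
  have hsurj : Function.Surjective φ := by
    rw [← LinearMap.range_eq_top]
    apply Submodule.eq_top_of_finrank_eq
    have h1 := φ.finrank_range_add_finrank_ker
    have h2 := finrank_orthogonal_span_range hB hu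
    rw [hker] at h1
    rw [Module.finrank_fin_fun]
    omega
  have h := φ.toAddMonoidHom.ncard_fiber hsurj c
  have hset : {x | φ.toAddMonoidHom x = c} = {x | ∀ i, B (u i) x = c i} := by
    ext x
    exact funext_iff
  rw [hset] at h
  rw [h, Nat.card_fun, Nat.card_fin, Nat.cast_pow]

theorem ncard_apply_eq_zero (hB : IsSymplecticForm B) {v : V} (hv : v ≠ 0) :
    ({x | B v x = 0}.ncard : ℝ) = Nat.card V / Nat.card F := by
  have h := ncard_forall_apply_eq hB (u := ![v]) (by simpa using hv) 0
  simpa using h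

theorem ncard_apply_ne_zero (hB : IsSymplecticForm B) {v : V} (hv : v ≠ 0) :
    ({x | B v x ≠ 0}.ncard : ℝ) = Nat.card V - Nat.card V / Nat.card F := by
  rw [← ncard_apply_eq_zero hB hv, eq_sub_iff_add_eq', ← Set.ncard_add_ncard_compl {x | B v x = 0}]
  push_cast
  rfl

/-- The cross terms of `B x (N x)` coincide and cancel in characteristic two, so the map is
additive. It is onto because scaling `x` by `s` multiplies the value by `s ^ 2`, and every element
of `F` is a square. -/
theorem ncard_apply_self_ne_zero [CharP F 2] (hB : IsSymplecticForm B) {N : End F V}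
    (hN : IsSqZeroSelfAdjoint B N) (ha : ¬ IsAlternatingEnd B N) :
    ({x | B x (N x) ≠ 0}.ncard : ℝ) = Nat.card V - Nat.card V / Nat.card F := by
  let φ : V →+ F := AddMonoidHom.mk' (fun x => B x (N x)) fun x y => by
    have : B y (N x) = B x (N y) := by rw [← hN.adjoint, hB.symm]
    simp only [map_add, LinearMap.add_apply, this]
    linear_combination CharTwo.add_self_eq_zero (B x (N y))
  refine φ.ncard_ne_zero fun a => ?_
  obtain ⟨x, hx⟩ := not_forall.1 ha
  have := Fintype.ofFinite F
  obtain ⟨s, hs⟩ := FiniteField.isSquare_of_char_two (ringChar.eq F 2) (a / B x (N x))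
  refine ⟨s • x, ?_⟩
  change B (s • x) (N (s • x)) = a
  simp only [map_smul, LinearMap.smul_apply, smul_eq_mul]
  rw [← mul_assoc, ← hs, div_mul_cancel₀ _ hx]

omit [Finite F] [Module F V] in
theorem ncard_setOf_ne_zero : ({v : V | v ≠ 0}.ncard : ℝ) = Nat.card V - 1 := by
  rw [eq_sub_iff_add_eq', ← Set.ncard_add_ncard_compl {(0 : V)},
    Set.ncard_singleton]
  push_cast
  rfl

theorem ncard_pairs_apply_ne_zero (hB : IsSymplecticForm B) :
    ({p : V × V | B p.1 p.2 ≠ 0}.ncard : ℝ) =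
      (Nat.card V - 1) * (Nat.card V - Nat.card V / Nat.card F) := by
  rw [ncard_eq_ncard_mul (t := {v | v ≠ 0}) (p := Prod.fst)
    (s := Nat.card V - Nat.card V / Nat.card F)]
  · congr 1
    exact ncard_setOf_ne_zero
  · rintro ⟨v, w⟩ h rfl
    exact h (by simp)
  · intro v hv
    rw [← ncard_apply_ne_zero hB hv,
      ← Set.ncard_image_of_injective {x | B v x ≠ 0} (Prod.mk_right_injective v)]
    congr 2
    ext ⟨v', w⟩
    constructor
    · rintro ⟨hp, rfl⟩
      exact ⟨w, hp, rfl⟩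
    · rintro ⟨w, hw, h⟩
      cases h
      exact ⟨hw, rfl⟩

/-- Recursion for the number of self-adjoint endomorphisms of square zero. -/
theorem sqZeroCount_eq [CharP F 2] (hB : IsSymplecticForm B) {a : ℝ}
    (h : ∀ W : Submodule F V, finrank F V = finrank F W + 2 → IsSymplecticForm (B.restrict W) →
      (sqZeroCount (B.restrict W) : ℝ) = a) :
    (sqZeroCount B : ℝ) = (Nat.card V - 1) * a + altRankSum B (fun _ => 1) := by
  have : Finite (End F V) := DFunLike.finite _
  set κ : ℝ := Nat.card V - Nat.card V / Nat.card F with hκ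
  -- `P` is counted by `N` and by `(v, N v)`. Each non-alternating `N` admits `κ` vectors, and each
  -- `v ≠ 0` admits `κ` values `w`, so `κ` cancels.
  let P : Set (End F V × V) := {p | IsSqZeroSelfAdjoint B p.1 ∧ B p.2 (p.1 p.2) ≠ 0}
  have h1 : (P.ncard : ℝ) = {N | IsSqZeroSelfAdjoint B N ∧ ¬ IsAlternatingEnd B N}.ncard * κ := by
    apply ncard_eq_ncard_mul (p := Prod.fst)
    · exact fun p hp => ⟨hp.1, fun h => hp.2 (h _)⟩
    · intro N hN
      rw [hκ, ← ncard_apply_self_ne_zero hB hN.1 hN.2,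
        ← Set.ncard_image_of_injective {x | B x (N x) ≠ 0} (Prod.mk_right_injective N)]
      congr 2
      ext ⟨N', v⟩
      constructor
      · rintro ⟨hp, rfl⟩
        exact ⟨v, hp.2, rfl⟩
      · rintro ⟨v, hv, h⟩
        cases h
        exact ⟨⟨hN.1, hv⟩, rfl⟩
  have h2 : (P.ncard : ℝ) = {p : V × V | B p.1 p.2 ≠ 0}.ncard * a := by
    apply ncard_eq_ncard_mul (p := fun p => (p.2, p.1 p.2))
    · exact fun p hp => hp.2
    · rintro ⟨v, w⟩ hvw
      obtain ⟨W, hW, hBW, hc⟩ := exists_ncard_eq_sqZeroCount hB hvw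
      rw [← h W hW hBW, ← hc,
        ← Set.ncard_image_of_injective {N | IsSqZeroSelfAdjoint B N ∧ N v = w} (Prod.mk_left_injective v)]
      congr 2
      ext ⟨N, v'⟩
      constructor
      · rintro ⟨hp, h⟩
        cases h
        exact ⟨N, ⟨hp.1, rfl⟩, rfl⟩
      · rintro ⟨N, ⟨hN, rfl⟩, h⟩
        cases h
        exact ⟨⟨hN, hvw⟩, rfl⟩
  have h3 : (sqZeroCount B : ℝ) = {N | IsSqZeroSelfAdjoint B N ∧ IsAlternatingEnd B N}.ncard +
      {N | IsSqZeroSelfAdjoint B N ∧ ¬ IsAlternatingEnd B N}.ncard := by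
    rw [sqZeroCount, ← Set.ncard_inter_add_ncard_sdiff_eq_ncard _ {N | IsAlternatingEnd B N}]
    push_cast
    rfl
  rw [h3, altRankSum, finsum_mem_const_eq_ncard_mul, mul_one, add_comm]
  congr 1
  rw [ncard_pairs_apply_ne_zero hB, h1] at h2
  have hF : (1 : ℝ) < Nat.card F := by exact_mod_cast Finite.one_lt_card
  have hV : (0 : ℝ) < Nat.card V := by exact_mod_cast Nat.card_pos
  have : κ ≠ 0 := by
    have : Nat.card V / (Nat.card F : ℝ) < Nat.card V := div_lt_self hV hF
    rw [hκ]
    exact (sub_pos.2 this).ne'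
  rw [← hκ] at h2
  exact mul_right_cancel₀ this (by rw [h2]; ring)

/-- Fix `v'` with `B v' w ≠ 0`. The possible values `N v'` satisfy three independent affine
conditions, given by pairing with `v, v', w`. This leaves `|V| / q ^ 3` choices, and each splits off
a 4-space. -/
theorem finsum_alternating_apply_eq [CharP F 2] (hB : IsSymplecticForm B) {f : ℕ → ℝ} {s : ℝ}
    (h : ∀ W : Submodule F V, finrank F V = finrank F W + 4 → IsSymplecticForm (B.restrict W) →
      altRankSum (B.restrict W) (fun r => f (2 + r)) = s) {v w : V} (hvw : B v w = 0)
    (hv : v ≠ 0) (hw : w ∉ Submodule.span F {v}) :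
    ∑ᶠ N ∈ {N | (IsSqZeroSelfAdjoint B N ∧ IsAlternatingEnd B N) ∧ N v = w},
      f (finrank F (range N)) = Nat.card V / (Nat.card F : ℝ) ^ 3 * s := by
  have : Finite (End F V) := DFunLike.finite _
  have hw0 : w ≠ 0 := by rintro rfl; exact hw (zero_mem _)
  obtain ⟨v', hv'⟩ : ∃ v', B w v' ≠ 0 := by
    by_contra! hcon
    exact hw0 (hB.nondeg w hcon)
  have hv'w : B v' w ≠ 0 := by rwa [hB.symm]
  have hwv : B w v = 0 := by rwa [hB.symm]
  have hind : LinearIndependent F ![v, v', w] := by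
    rw [Fintype.linearIndependent_iff]
    intro a ha
    rw [Fin.sum_univ_three] at ha
    have h1 : a 1 = 0 := by
      have := congrArg (B w) ha
      simpa [hwv, hB.alt, hv'] using this
    have h2 : a 2 = 0 := by
      by_contra h2
      apply hw
      rw [Submodule.mem_span_singleton]
      refine ⟨-(a 2)⁻¹ * a 0, ?_⟩
      have : a 2 • w = - (a 0 • v) := by
        rw [eq_neg_iff_add_eq_zero, add_comm]
        simpa [h1] using ha
      rw [neg_mul, neg_smul, mul_smul, ← smul_neg, ← this, smul_smul, inv_mul_cancel₀ h2, one_smul]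
    have h0 : a 0 = 0 := by simpa [h1, h2, hv] using ha
    simp [Fin.forall_fin_succ, h0, h1, h2]
  rw [← ncard_forall_apply_eq hB hind ![B v' w, 0, 0]]
  refine finsum_mem_eq_ncard_mul (p := fun N : End F V => N v') ?_ ?_
  · rintro N ⟨⟨hN, ha⟩, rfl⟩
    simp only [Set.mem_ofPred_eq, Fin.forall_fin_succ]
    refine ⟨?_, ha v', ?_, fun i => i.elim0⟩
    · change B v (N v') = B v' (N v)
      rw [← hN.adjoint, hB.symm]
    · change B (N v) (N v') = 0
      rw [← hN.adjoint, hN.sq_zero]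
      simp
  · intro w' hw'
    simp only [Set.mem_ofPred_eq, Fin.forall_fin_succ] at hw'
    obtain ⟨e0, e1, e2, -⟩ := hw'
    obtain ⟨W, hW, hBW, hs⟩ := exists_finsum_eq_altRankSum hB hvw hv'w e0 e1 e2
    rw [← h W hW hBW, ← hs f]
    exact finsum_mem_congr (by ext; simp [and_assoc]) fun _ _ => rfl

theorem ncard_ne_zero_of_rank (N : End F V) :
    ({v | N v ≠ 0}.ncard : ℝ) =
      Nat.card V - Nat.card V / (Nat.card F : ℝ) ^ finrank F (range N) := by
  have hF : (Nat.card F : ℝ) ≠ 0 := Nat.cast_ne_zero.2 Nat.card_pos.ne'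
  have h1 : (Nat.card V : ℝ) / (Nat.card F : ℝ) ^ finrank F (range N) =
      {v | N v = 0}.ncard := by
    have h2 : {v | N v = 0}.ncard = Nat.card (LinearMap.ker N) := rfl
    rw [h2, Module.natCard_eq_pow_finrank (K := F) (V := V),
      Module.natCard_eq_pow_finrank (K := F) (V := LinearMap.ker N),
      ← N.finrank_range_add_finrank_ker]
    push_cast
    rw [pow_add]
    field_simp
  rw [h1, eq_sub_iff_add_eq', ← Set.ncard_add_ncard_compl {v | N v = 0}]
  push_cast
  rfl

theorem ncard_pairs_notMem_span (hB : IsSymplecticForm B) :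
    ({p : V × V | p.1 ≠ 0 ∧ B p.1 p.2 = 0 ∧ p.2 ∉ Submodule.span F {p.1}}.ncard : ℝ) =
      (Nat.card V - 1) * (Nat.card V / Nat.card F - Nat.card F) := by
  rw [ncard_eq_ncard_mul (t := {v | v ≠ 0}) (p := Prod.fst)
    (s := Nat.card V / Nat.card F - Nat.card F)]
  · congr 1
    exact ncard_setOf_ne_zero
  · exact fun p hp => hp.1
  · intro v hv
    have hspan : ((Submodule.span F {v} : Set V).ncard) = Nat.card F := by
      have h2 : (Submodule.span F {v} : Set V).ncard = Nat.card (Submodule.span F {v}) := rfl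
      rw [h2, Module.natCard_eq_pow_finrank (K := F), finrank_span_singleton hv, pow_one]
    have hsub : (Submodule.span F {v} : Set V) ⊆ {w | B v w = 0} := by
      intro w hw
      obtain ⟨a, rfl⟩ := Submodule.mem_span_singleton.1 hw
      simp [hB.alt]
    rw [← ncard_apply_eq_zero hB hv, ← hspan, eq_sub_iff_add_eq,
      ← Set.ncard_sdiff_add_ncard_of_subset hsub,
      ← Set.ncard_image_of_injective ({w | B v w = 0} \ _) (Prod.mk_right_injective v)]
    push_cast
    congr 3
    ext ⟨v', w⟩
    constructor
    · rintro ⟨hp, rfl⟩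
      exact ⟨w, hp.2, rfl⟩
    · rintro ⟨w, hw, h⟩
      cases h
      exact ⟨⟨hv, hw⟩, rfl⟩

/-- Recursion for the rank distribution of the alternating endomorphisms. -/
theorem altRankSum_mul_eq [CharP F 2] (hB : IsSymplecticForm B) {f : ℕ → ℝ} {s : ℝ}
    (h : ∀ W : Submodule F V, finrank F V = finrank F W + 4 → IsSymplecticForm (B.restrict W) →
      altRankSum (B.restrict W) (fun r => f (2 + r)) = s) :
    altRankSum B (fun r => (Nat.card V - Nat.card V / (Nat.card F : ℝ) ^ r) * f r) =
      (Nat.card V - 1) * (Nat.card V / Nat.card F - Nat.card F) *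
        (Nat.card V / (Nat.card F : ℝ) ^ 3 * s) := by
  have : Finite (End F V) := DFunLike.finite _
  let P : Set (End F V × V) :=
    {p | (IsSqZeroSelfAdjoint B p.1 ∧ IsAlternatingEnd B p.1) ∧ p.1 p.2 ≠ 0}
  have h1 : ∑ᶠ p ∈ P, f (finrank F (range p.1)) =
      altRankSum B (fun r => (Nat.card V - Nat.card V / (Nat.card F : ℝ) ^ r) * f r) := by
    rw [← finsum_mem_fiberwise (p := Prod.fst)
      (t := {N | IsSqZeroSelfAdjoint B N ∧ IsAlternatingEnd B N}) fun p hp => hp.1]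
    refine finsum_mem_congr rfl fun N hN => ?_
    beta_reduce
    rw [← ncard_ne_zero_of_rank, ← finsum_mem_const_eq_ncard_mul]
    symm
    refine finsum_mem_eq_of_bijOn (fun v => (N, v)) ⟨fun v hv => ⟨⟨hN, hv⟩, rfl⟩,
      (Prod.mk_right_injective N).injOn, ?_⟩ fun _ _ => rfl
    rintro ⟨N', v⟩ ⟨hp, rfl⟩
    exact ⟨v, hp.2, rfl⟩
  rw [← h1, ← ncard_pairs_notMem_span hB]
  refine finsum_mem_eq_ncard_mul (p := fun p : End F V × V => (p.2, p.1 p.2)) ?_ ?_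
  · rintro ⟨N, v⟩ ⟨⟨hN, ha⟩, hv : N v ≠ 0⟩
    refine ⟨fun h0 : v = 0 => hv (by rw [h0, map_zero]), ha v, fun hmem => ?_⟩
    -- A square-zero map has no nonzero eigenvalue, so `N v ≠ 0` is not a multiple of `v`.
    obtain ⟨a, ha' : a • v = N v⟩ := Submodule.mem_span_singleton.1 hmem
    have := hN.sq_zero v
    rw [← ha', map_smul, smul_eq_zero] at this
    obtain rfl | this := this
    · exact hv (by rw [← ha', zero_smul])
    · exact hv this
  · rintro ⟨v, w⟩ ⟨hv, hvw, hw⟩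
    dsimp only at hv hvw hw
    rw [← finsum_alternating_apply_eq hB h hvw hv hw]
    symm
    refine finsum_mem_eq_of_bijOn (fun N => (N, v)) ⟨?_, (Prod.mk_left_injective v).injOn, ?_⟩
      fun _ _ => rfl
    · rintro N ⟨hN, rfl⟩
      refine ⟨⟨hN, fun h0 => hw ?_⟩, rfl⟩
      rw [h0]
      exact zero_mem _
    · rintro ⟨N, v'⟩ ⟨hp, h⟩
      cases h
      exact ⟨N, ⟨hp.1, rfl⟩, rfl⟩

end Counting

/-! ### q-products, Euler's identity and the limit of the double sum -/

section Products

/-- The product of `1 - y ^ i` over `1 ≤ i ≤ k`. -/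
noncomputable def qPoch (y : ℝ) (k : ℕ) : ℝ := ∏ i ∈ Finset.range k, (1 - y ^ (i + 1))

/-- The product of `Q ^ i - 1` over `1 ≤ i ≤ n`. -/
noncomputable def qFact (Q : ℝ) (n : ℕ) : ℝ := ∏ i ∈ Finset.range n, (Q ^ (i + 1) - 1)

variable {Q y : ℝ}

theorem qPoch_succ (y : ℝ) (k : ℕ) : qPoch y (k + 1) = qPoch y k * (1 - y ^ (k + 1)) :=
  Finset.prod_range_succ _ _

theorem qFact_succ (Q : ℝ) (n : ℕ) : qFact Q (n + 1) = qFact Q n * (Q ^ (n + 1) - 1) :=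
  Finset.prod_range_succ _ _

theorem qPoch_zero (y : ℝ) : qPoch y 0 = 1 := Finset.prod_range_zero _

theorem qFact_zero (Q : ℝ) : qFact Q 0 = 1 := Finset.prod_range_zero _

theorem half_le_qPoch (h0 : 0 ≤ y) (h1 : y ≤ 1 / 4) (k : ℕ) : 1 / 2 ≤ qPoch y k := by
  -- The extra `y ^ k / 2` gives the induction room to absorb the next factor, because `y ^ (k + 1)
  -- ≤ y ^ k / 4`.
  have key : 1 / 2 + y ^ k / 2 ≤ qPoch y k := by
    induction k with
    | zero => rw [qPoch_zero]; norm_num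
    | succ k ih =>
      rw [qPoch_succ]
      have ht0 : 0 ≤ y ^ k := pow_nonneg h0 k
      have ht1 : y ^ k ≤ 1 := pow_le_one₀ h0 (by linarith)
      have hty : y ^ (k + 1) = y ^ k * y := pow_succ y k
      have hs : y ^ (k + 1) ≤ y ^ k * (1 / 4) := by rw [hty]; gcongr
      have hs0 : 0 ≤ y ^ (k + 1) := pow_nonneg h0 _
      refine le_trans ?_ (mul_le_mul_of_nonneg_right ih (by linarith))
      nlinarith [mul_le_mul_of_nonneg_right ht1 hs0]
  have := pow_nonneg h0 k
  linarith

theorem qPoch_pos (h0 : 0 ≤ y) (h1 : y ≤ 1 / 4) (k : ℕ) : 0 < qPoch y k :=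
  lt_of_lt_of_le (by norm_num) (half_le_qPoch h0 h1 k)

theorem three_le_pow_succ_sub_one (hQ : 4 ≤ Q) (n : ℕ) : 3 ≤ Q ^ (n + 1) - 1 := by
  have := pow_le_pow_right₀ (by linarith : 1 ≤ Q) (Nat.le_add_left 1 n)
  linarith

theorem qFact_pos (hQ : 4 ≤ Q) (n : ℕ) : 0 < qFact Q n :=
  Finset.prod_pos fun i _ => by linarith [three_le_pow_succ_sub_one hQ i]

theorem qFact_eq (q : ℝ) (hq : q ≠ 0) (n : ℕ) :
    qFact (q ^ 2) n = q ^ (n ^ 2 + n) * qPoch (1 / q ^ 2) n := by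
  induction n with
  | zero => simp [qFact_zero, qPoch_zero]
  | succ n ih =>
    rw [qFact_succ, qPoch_succ, ih, show (n + 1) ^ 2 + (n + 1) = n ^ 2 + n + 2 * (n + 1) by ring,
      pow_add q (n ^ 2 + n), pow_mul q 2, div_pow, one_pow]
    have : (q ^ 2) ^ (n + 1) ≠ 0 := pow_ne_zero _ (pow_ne_zero _ hq)
    field_simp

theorem summable_inv_qFact (hQ : 4 ≤ Q) : Summable fun n => 1 / qFact Q n := by
  have hle : ∀ n, 1 / qFact Q n ≤ (1 / 3) ^ n := fun n => by
    induction n with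
    | zero => simp [qFact_zero]
    | succ n ih =>
      rw [qFact_succ, pow_succ (1 / 3 : ℝ), ← one_div_mul_one_div]
      exact mul_le_mul ih (one_div_le_one_div_of_le (by norm_num) (three_le_pow_succ_sub_one hQ n))
        (one_div_nonneg.2 (by linarith [three_le_pow_succ_sub_one hQ n])) (by positivity)
  exact Summable.of_nonneg_of_le (fun n => one_div_nonneg.2 (qFact_pos hQ n).le) hle
    (summable_geometric_of_lt_one (by norm_num) (by norm_num))

/-- The sum telescopes: for `k ≥ 1` its `k`-th term is `1 / qPoch y k - 1 / qPoch y (k - 1)`. -/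
theorem sum_pow_div_qPoch (h0 : 0 ≤ y) (h1 : y ≤ 1 / 4) (n : ℕ) :
    ∑ k ∈ Finset.range (n + 1), y ^ k / qPoch y k = 1 / qPoch y n := by
  induction n with
  | zero => simp
  | succ n ih =>
    rw [Finset.sum_range_succ, ih]
    have e := qPoch_succ y n
    have p1 := (qPoch_pos h0 h1 n).ne'
    have p2 := (qPoch_pos h0 h1 (n + 1)).ne'
    field_simp
    rw [e]
    ring

theorem summable_pow_div_qPoch (h0 : 0 ≤ y) (h1 : y ≤ 1 / 4) :
    Summable fun k => y ^ k / qPoch y k := by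
  refine Summable.of_nonneg_of_le (fun k => div_nonneg (pow_nonneg h0 k) (qPoch_pos h0 h1 k).le)
    (fun k => ?_) ((summable_geometric_of_lt_one h0 (by linarith)).mul_right 2)
  rw [div_le_iff₀ (qPoch_pos h0 h1 k)]
  nlinarith [half_le_qPoch h0 h1 k, pow_nonneg h0 k]

/-- Euler's identity for the product of `1 + Q⁻ⁱ`. -/
theorem tendsto_prod_one_add_inv_pow (hQ : 4 ≤ Q) :
    Filter.Tendsto (fun n => ∏ i ∈ Finset.range n, (1 + 1 / Q ^ (i + 1))) Filter.atTop
      (nhds (∑' j, 1 / qFact Q j)) := by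
  have hQ0 : 0 < Q := by linarith
  let g : ℝ → ℝ := fun t => ∑' j, 1 / qFact Q j * t ^ j
  have hv := summable_inv_qFact hQ
  have hpos (j) : 0 ≤ 1 / qFact Q j := one_div_nonneg.2 (qFact_pos hQ j).le
  have hbound (t : ℝ) (ht0 : 0 ≤ t) (ht1 : t ≤ 1) (j : ℕ) :
      ‖1 / qFact Q j * t ^ j‖ ≤ 1 / qFact Q j := by
    rw [Real.norm_of_nonneg (mul_nonneg (hpos j) (pow_nonneg ht0 j))]
    exact mul_le_of_le_one_right (hpos j) (pow_le_one₀ ht0 ht1)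
  have hsum (t : ℝ) (ht0 : 0 ≤ t) (ht1 : t ≤ 1) : Summable fun j => 1 / qFact Q j * t ^ j :=
    Summable.of_norm_bounded hv (hbound t ht0 ht1)
  have hinv0 (n : ℕ) : 0 ≤ 1 / Q ^ n := by positivity
  have hinv1 (n : ℕ) : 1 / Q ^ n ≤ 1 := by
    rw [div_le_one (by positivity)]
    exact one_le_pow₀ (by linarith)
  -- This is the functional equation `g t = (1 + t / Q) * g (t / Q)` at `t = 1 / Q ^ n`, checked
  -- coefficientwise. Iterating it from `t = 1` builds the product, and `g t → 1` as `t → 0`.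
  have hfun (n : ℕ) : g (1 / Q ^ n) = (1 + 1 / Q ^ (n + 1)) * g (1 / Q ^ (n + 1)) := by
    have s1 := hsum _ (hinv0 n) (hinv1 n)
    have s2 := hsum _ (hinv0 (n + 1)) (hinv1 (n + 1))
    simp only [g]
    rw [one_add_mul, s1.tsum_eq_zero_add]
    nth_rw 1 [s2.tsum_eq_zero_add]
    rw [pow_zero, pow_zero, add_assoc, ← tsum_mul_left,
      ← ((summable_nat_add_iff 1).2 s2).tsum_add (s2.mul_left _)]
    congr 1
    refine tsum_congr fun j => ?_
    have p1 := (qFact_pos hQ j).ne'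
    have p2 : Q ^ (j + 1) - 1 ≠ 0 := by linarith [three_le_pow_succ_sub_one hQ j]
    rw [qFact_succ, pow_succ Q n]
    simp only [div_pow, one_pow, mul_pow]
    have p3 : (Q ^ n) ≠ 0 := by positivity
    field_simp
    ring
  have hprod (n : ℕ) :
      (∏ i ∈ Finset.range n, (1 + 1 / Q ^ (i + 1))) * g (1 / Q ^ n) = ∑' j, 1 / qFact Q j := by
    induction n with
    | zero => simp [g]
    | succ n ih => rw [Finset.prod_range_succ, mul_assoc, ← hfun, ih]
  have hg : Filter.Tendsto (fun n : ℕ => g (1 / Q ^ n)) Filter.atTop (nhds 1) := by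
    have h0 : Filter.Tendsto (fun n : ℕ => 1 / Q ^ n) Filter.atTop (nhds 0) := by
      simpa only [one_div, inv_pow] using
        tendsto_pow_atTop_nhds_zero_of_lt_one (inv_nonneg.2 hQ0.le)
          (inv_lt_one_of_one_lt₀ (by linarith : 1 < Q))
    have h1 := tendsto_tsum_of_dominated_convergence (𝓕 := Filter.atTop)
      (f := fun (n j : ℕ) => 1 / qFact Q j * (1 / Q ^ n) ^ j)
      (g := fun j => 1 / qFact Q j * 0 ^ j) hv
      (fun j => (h0.pow j).const_mul _)
      (Filter.Eventually.of_forall fun n j => hbound _ (hinv0 n) (hinv1 n) j)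
    have h2 : ∑' j : ℕ, 1 / qFact Q j * 0 ^ j = 1 := by
      rw [tsum_eq_single 0 fun j hj => by rw [zero_pow hj, mul_zero]]
      simp [qFact_zero]
    rwa [h2] at h1
  have hlim := (tendsto_const_nhds (x := ∑' j, 1 / qFact Q j)).div hg one_ne_zero
  rw [div_one] at hlim
  refine hlim.congr' ?_
  filter_upwards [hg.eventually_ne one_ne_zero] with n hn
  rw [Pi.div_apply, ← hprod n, mul_div_cancel_right₀ _ hn]

theorem sum_range_sum_range_half (G : ℕ → ℕ → ℝ) (n : ℕ) :
    ∑ m ∈ Finset.range (n + 1), ∑ k ∈ Finset.range (m / 2 + 1), G k (m - 2 * k) =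
      ∑ p ∈ Finset.range (n + 1) ×ˢ Finset.range (n + 1) with 2 * p.1 + p.2 ≤ n, G p.1 p.2 := by
  rw [Finset.sum_sigma']
  refine Finset.sum_nbij' (fun p => (p.2, p.1 - 2 * p.2)) (fun p => ⟨2 * p.1 + p.2, p.1⟩)
    ?_ ?_ ?_ ?_ ?_
  · rintro ⟨m, k⟩ h
    simp only [Finset.mem_sigma, Finset.mem_range, Finset.mem_filter, Finset.mem_product] at h ⊢
    omega
  · rintro ⟨k, j⟩ h
    simp only [Finset.mem_sigma, Finset.mem_range, Finset.mem_filter, Finset.mem_product] at h ⊢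
    omega
  · rintro ⟨m, k⟩ h
    simp only [Finset.mem_sigma, Finset.mem_range] at h
    have : 2 * k + (m - 2 * k) = m := by omega
    simp [this]
  · rintro ⟨k, j⟩ _
    simp
  · intro _ _
    rfl

/-- The index sets `2k + j ≤ n` exhaust `ℕ × ℕ`, so the double sum tends to a product of two series.
The prefactor is the inverse of a partial sum of the first series, which therefore cancels. -/
theorem tendsto_qPoch_mul_sum (hQ : 4 ≤ Q) :
    Filter.Tendsto (fun n => qPoch (1 / Q) n * ∑ m ∈ Finset.range (n + 1),
      ∑ k ∈ Finset.range (m / 2 + 1), (1 / Q) ^ k / qPoch (1 / Q) k * (1 / qFact Q (m - 2 * k)))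
      Filter.atTop (nhds (∑' j, 1 / qFact Q j)) := by
  have h0 : 0 ≤ 1 / Q := by positivity
  have h1 : 1 / Q ≤ 1 / 4 := one_div_le_one_div_of_le (by norm_num) hQ
  have hu := summable_pow_div_qPoch h0 h1
  have hu0 (k) : 0 ≤ (1 / Q) ^ k / qPoch (1 / Q) k :=
    div_nonneg (pow_nonneg h0 k) (qPoch_pos h0 h1 k).le
  have hv := summable_inv_qFact hQ
  set U := ∑' k, (1 / Q) ^ k / qPoch (1 / Q) k with hU
  have hU1 : 1 ≤ U := by
    have := hu.le_tsum 0 fun k _ => hu0 k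
    rwa [pow_zero, qPoch_zero, div_one] at this
  have hmul := hu.hasSum.mul hv.hasSum
    (hu.mul_of_nonneg hv hu0 fun j => one_div_nonneg.2 (qFact_pos hQ j).le)
  have hS := hmul.comp (Filter.tendsto_atTop_finset_of_monotone
    (f := fun n : ℕ => {p ∈ Finset.range (n + 1) ×ˢ Finset.range (n + 1) | 2 * p.1 + p.2 ≤ n})
    (fun a b hab p hp => by
      simp only [Finset.mem_range, Finset.mem_filter, Finset.mem_product] at hp ⊢
      omega)
    (fun p => ⟨2 * p.1 + p.2, by
      simp only [Finset.mem_range, Finset.mem_filter, Finset.mem_product]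
      omega⟩))
  have hP : Filter.Tendsto (fun n => 1 / qPoch (1 / Q) n) Filter.atTop (nhds U) := by
    have := hu.hasSum.tendsto_sum_nat.comp (Filter.tendsto_add_atTop_nat 1)
    refine this.congr fun n => ?_
    exact sum_pow_div_qPoch h0 h1 n
  have hlim := hS.div hP (by linarith)
  rw [← hU, mul_div_cancel_left₀ _ (by linarith : U ≠ 0)] at hlim
  refine hlim.congr fun n => ?_
  rw [sum_range_sum_range_half (fun k j => (1 / Q) ^ k / qPoch (1 / Q) k * (1 / qFact Q j))]
  simp only [Pi.div_apply, Function.comp_apply]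
  rw [div_div_eq_mul_div, div_one, mul_comm]

end Products

/-! ### Solving the recursions -/

section Formula

/-- Dividing `f` by the weight in `altRankSum_mul_eq` isolates `altRankSum B f`, except that the
weight vanishes at rank zero; `N = 0` is added back as `f 0`. -/
theorem altRankSum_eq_add {F V : Type*} [Field F] [AddCommGroup V] [Module F V] [Finite F]
    [Finite V] [CharP F 2] {B : BilinForm F V} (hB : IsSymplecticForm B) {f : ℕ → ℝ} {s : ℝ}
    (h : ∀ W : Submodule F V, finrank F V = finrank F W + 4 → IsSymplecticForm (B.restrict W) →
      altRankSum (B.restrict W) (fun r => f (2 + r) /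
        (Nat.card V - Nat.card V / (Nat.card F : ℝ) ^ (2 + r))) = s) :
    altRankSum B f = f 0 + (Nat.card V - 1) * (Nat.card V / Nat.card F - Nat.card F) *
        (Nat.card V / (Nat.card F : ℝ) ^ 3 * s) := by
  have : Finite (End F V) := DFunLike.finite _
  have hF : (1 : ℝ) < Nat.card F := by exact_mod_cast Finite.one_lt_card
  have hV : (0 : ℝ) < Nat.card V := by exact_mod_cast Nat.card_pos
  rw [← altRankSum_mul_eq hB (f := fun r => f r /
    (Nat.card V - Nat.card V / (Nat.card F : ℝ) ^ r)) h]
  set S := {N : End F V | IsSqZeroSelfAdjoint B N ∧ IsAlternatingEnd B N}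
  have h0 : (0 : End F V) ∈ S := ⟨⟨fun _ => by simp, fun _ _ => by simp⟩, fun _ => by simp⟩
  have hsplit (g : ℕ → ℝ) : altRankSum B g =
      g 0 + ∑ᶠ N ∈ S \ {0}, g (finrank F (range N)) := by
    have := finsum_mem_insert (fun N : End F V => g (finrank F (range N)))
      (show (0 : End F V) ∉ S \ {0} by simp) (Set.toFinite _)
    have hz : finrank F (range (0 : End F V)) = 0 := by
      rw [Submodule.finrank_eq_zero, LinearMap.range_eq_bot]
    rwa [Set.insert_sdiff_singleton, Set.insert_eq_of_mem h0, hz] at this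
  rw [hsplit f, hsplit, pow_zero, div_one, sub_self, zero_mul, zero_add]
  congr 1
  refine finsum_mem_congr rfl fun N hN => ?_
  have hr : finrank F (range N) ≠ 0 := fun hr => hN.2 <| by
    rw [Submodule.finrank_eq_zero, LinearMap.range_eq_bot] at hr
    exact hr
  have hne : (Nat.card V : ℝ) - Nat.card V / (Nat.card F : ℝ) ^ finrank F (range N) ≠ 0 :=
    (sub_pos.2 (div_lt_self hV (one_lt_pow₀ hF hr))).ne'
  rw [mul_div_cancel₀ _ hne]

/-- The recursion lowers the dimension by 4, hence the two-step induction on `n`. It also shifts and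
rescales `f`, so `f` must stay arbitrary. -/
theorem altRankSum_formula {F : Type*} [Field F] [Finite F] [CharP F 2] {Q : ℝ}
    (hQ : Q = (Nat.card F : ℝ) ^ 2) (hQ4 : 4 ≤ Q) (n : ℕ) : ∀ {V : Type*} [AddCommGroup V]
    [Module F V] [Finite V] {B : BilinForm F V}, IsSymplecticForm B → finrank F V = 2 * n →
    ∀ f : ℕ → ℝ, altRankSum B f = qFact Q n * ∑ k ∈ Finset.range (n / 2 + 1),
      f (2 * k) * ((1 / Q) ^ k / qPoch (1 / Q) k * (1 / qFact Q (n - 2 * k))) := by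
  have hF : (Nat.card F : ℝ) ≠ 0 := Nat.cast_ne_zero.2 Nat.card_pos.ne'
  have hQ0 : Q ≠ 0 := by linarith
  have hcard {V : Type _} [AddCommGroup V] [Module F V] [Finite V] {n : ℕ}
      (hV : finrank F V = 2 * n) : (Nat.card V : ℝ) = Q ^ n := by
    rw [Module.natCard_eq_pow_finrank (K := F), hV, hQ, Nat.cast_pow, pow_mul]
  induction n using Nat.twoStepInduction with
  | zero =>
    intro V _ _ _ B hB hV f
    -- No subspace has codimension 4 here, so `s` may be chosen as `0`, which removes the second
    -- term.
    rw [altRankSum_eq_add hB (s := 0) fun W hW => by omega]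
    simp [qPoch_zero, qFact_zero]
  | one =>
    intro V _ _ _ B hB hV f
    rw [altRankSum_eq_add hB (s := 0) fun W hW => by omega]
    have := (qFact_pos hQ4 1).ne'
    simp [qPoch_zero]
    field_simp
  | more n ih _ =>
    intro V _ _ _ B hB hV f
    rw [altRankSum_eq_add hB fun W hW hBW => ih hBW (by omega) _, hcard hV,
      show (n + 2) / 2 + 1 = n / 2 + 1 + 1 by omega, Finset.sum_range_succ' _ (n / 2 + 1), mul_add, add_comm]
    congr 1
    · rw [Finset.mul_sum, Finset.mul_sum, Finset.mul_sum, Finset.mul_sum]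
      refine Finset.sum_congr rfl fun k _ => ?_
      have e1 : (Nat.card F : ℝ) ^ (2 + 2 * k) = Q ^ (k + 1) := by
        rw [hQ, ← pow_mul]; ring_nf
      have e2 : Q ^ (n + 2) / (Nat.card F : ℝ) - Nat.card F = Nat.card F * (Q ^ (n + 1) - 1) := by
        rw [pow_succ Q (n + 1)]
        nth_rw 2 [hQ]
        field_simp
      have e3 : (Nat.card F : ℝ) ^ 3 = Nat.card F * Q := by rw [hQ]; ring
      have e4 : (n + 2 - 2 * (k + 1)) = n - 2 * k := by omega
      have e5 : 2 + 2 * k = 2 * (k + 1) := by omega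
      have e6 : Q ^ (n + 2) - Q ^ (n + 2) / Q ^ (k + 1) =
          Q ^ (n + 2) * (1 - (1 / Q) ^ (k + 1)) := by
        rw [one_div, inv_pow]; ring
      have h0 : 0 ≤ 1 / Q := by positivity
      have h1 : 1 / Q ≤ 1 / 4 := one_div_le_one_div_of_le (by norm_num) hQ4
      have p1 := (qPoch_pos h0 h1 k).ne'
      have p2 := (qPoch_pos h0 h1 (k + 1)).ne'
      rw [qPoch_succ] at p2
      have p3 := right_ne_zero_of_mul p2
      rw [e1, e2, e3, e4, e6, e5, qFact_succ, qFact_succ, qPoch_succ, pow_succ (1 / Q) k]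
      rw [pow_succ (1 / Q) k] at p3
      generalize (1 / Q) ^ k = t at *
      have p4 := (qFact_pos hQ4 (n - 2 * k)).ne'
      field_simp
    · have := (qFact_pos hQ4 (n + 2)).ne'
      simp [qPoch_zero, mul_left_comm, this]

/-- After division by `qFact Q n` the recursion becomes a plain summation, whose `m`-th term is the
normalised alternating count in dimension `2m`. -/
theorem sqZeroCount_formula {F : Type*} [Field F] [Finite F] [CharP F 2] {Q : ℝ}
    (hQ : Q = (Nat.card F : ℝ) ^ 2) (hQ4 : 4 ≤ Q) (n : ℕ) : ∀ {V : Type*} [AddCommGroup V]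
    [Module F V] [Finite V] {B : BilinForm F V}, IsSymplecticForm B → finrank F V = 2 * n →
    (sqZeroCount B : ℝ) = qFact Q n * ∑ m ∈ Finset.range (n + 1),
      ∑ k ∈ Finset.range (m / 2 + 1), (1 / Q) ^ k / qPoch (1 / Q) k *
        (1 / qFact Q (m - 2 * k)) := by
  have hcard {V : Type _} [AddCommGroup V] [Module F V] [Finite V] {n : ℕ}
      (hV : finrank F V = 2 * n) : (Nat.card V : ℝ) = Q ^ n := by
    rw [Module.natCard_eq_pow_finrank (K := F), hV, hQ, Nat.cast_pow, pow_mul]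
  induction n with
  | zero =>
    intro V _ _ _ B hB hV
    rw [sqZeroCount_eq hB (a := 0) fun W hW => by omega, altRankSum_formula hQ hQ4 0 hB hV]
    simp
  | succ n ih =>
    intro V _ _ _ B hB hV
    rw [sqZeroCount_eq hB fun W hW hBW => ih hBW (by omega),
      altRankSum_formula hQ hQ4 (n + 1) hB hV, hcard hV, Finset.sum_range_succ _ (n + 1), mul_add,
      qFact_succ]
    simp only [one_mul]
    ring

end Formula

/-! ### From symplectic involutions to square-zero endomorphisms -/

section SymplecticGroup

variable (n : ℕ) (F : Type*) [Field F]

theorem toBilin'_J_apply_self [CharP F 2] (x : Fin n ⊕ Fin n → F) :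
    Matrix.toBilin' (Matrix.J (Fin n) F) x x = 0 := by
  rw [Matrix.toBilin'_apply', Matrix.J, Matrix.fromBlocks_mulVec]
  rw [dotProduct, Fintype.sum_sum_type, ← Finset.sum_add_distrib]
  refine Finset.sum_eq_zero fun i _ => ?_
  simp [Matrix.neg_mulVec]
  ring

theorem isSymplecticForm_J [CharP F 2] :
    IsSymplecticForm (Matrix.toBilin' (Matrix.J (Fin n) F)) where
  alt := toBilin'_J_apply_self n F
  symm x y := by
    have h := toBilin'_J_apply_self n F (x + y)
    simp only [map_add, LinearMap.add_apply, toBilin'_J_apply_self, zero_add, add_zero] at h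
    rw [← CharTwo.sub_eq_add, sub_eq_zero] at h
    exact h.symm
  nondeg := (LinearMap.BilinForm.nondegenerate_toBilin'_of_det_ne_zero' _
    (Matrix.isUnit_det_J (Fin n) F).ne_zero).1

/-- Membership means `A * J * Aᵀ = J`, so it is the transpose of `A` that acts as an isometry. -/
theorem mem_symplecticGroup_iff_toBilin' {A : Matrix (Fin n ⊕ Fin n) (Fin n ⊕ Fin n) F} :
    A ∈ Matrix.symplecticGroup (Fin n) F ↔
      ∀ x y, Matrix.toBilin' (Matrix.J (Fin n) F) (Matrix.toLin' A.transpose x)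
        (Matrix.toLin' A.transpose y) = Matrix.toBilin' (Matrix.J (Fin n) F) x y := by
  have h := Matrix.toBilin'_comp (Matrix.J (Fin n) F) A.transpose A.transpose
  rw [Matrix.transpose_transpose] at h
  rw [SymplecticGroup.mem_iff, ← Matrix.toBilin'.injective.eq_iff, ← h]
  exact ⟨fun h x y => LinearMap.congr_fun₂ h x y, fun h => LinearMap.ext₂ h⟩

theorem isSqZeroSelfAdjoint_sub_one_iff {F V : Type*} [Field F] [CharP F 2] [AddCommGroup V]
    [Module F V] {B : BilinForm F V} {T : End F V} :
    IsSqZeroSelfAdjoint B (T - 1) ↔ (∀ x y, B (T x) (T y) = B x y) ∧ T * T = 1 := by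
  obtain ⟨N, rfl⟩ : ∃ N, T = N + 1 := ⟨T - 1, by simp⟩
  have h2 (x : V) : x + x = 0 := by rw [← two_smul F x, CharTwo.two_eq_zero, zero_smul]
  rw [add_sub_cancel_right]
  constructor
  · intro h
    constructor
    · intro x y
      have e : B (N x) (N y) = 0 := by rw [h.adjoint, h.sq_zero, map_zero]
      simp only [LinearMap.add_apply, Module.End.one_apply, map_add, e, h.adjoint]
      linear_combination CharTwo.add_self_eq_zero (B x (N y))
    · ext x
      simp only [Module.End.mul_apply, LinearMap.add_apply, Module.End.one_apply, map_add,
        h.sq_zero, zero_add]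
      rw [← add_assoc, h2, zero_add]
  · rintro ⟨hB, hT⟩
    have hsq (x) : N (N x) = 0 := by
      have := LinearMap.congr_fun hT x
      simp only [Module.End.mul_apply, LinearMap.add_apply, Module.End.one_apply, map_add] at this
      rw [← add_assoc, add_eq_right, add_assoc, h2, add_zero] at this
      exact this
    have hadd (x y) : B (N x) (N y) + B x (N y) + B (N x) y = 0 := by
      have := hB x y
      simp only [LinearMap.add_apply, Module.End.one_apply, map_add] at this
      linear_combination this
    refine ⟨hsq, fun x y => ?_⟩
    -- Replacing `y` by `N y` and using `N ^ 2 = 0` leaves `B (N x) (N y) = 0`; the isometry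
    -- relation then reduces to self-adjointness.
    have e := hadd x (N y)
    rw [hsq, map_zero, map_zero, zero_add, zero_add] at e
    have := hadd x y
    rw [e, zero_add, add_comm] at this
    exact CharTwo.add_eq_zero.1 this

theorem symplecticInvolutionCount_eq_sqZeroCount [CharP F 2] :
    symplecticInvolutionCount n F = sqZeroCount (Matrix.toBilin' (Matrix.J (Fin n) F)) := by
  have hmul (A : Matrix (Fin n ⊕ Fin n) (Fin n ⊕ Fin n) F) :
      Matrix.toLin' A.transpose * Matrix.toLin' A.transpose = 1 ↔ A * A = 1 := by
    rw [Module.End.mul_eq_comp, ← Matrix.toLin'_mul, ← Matrix.transpose_mul,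
      Module.End.one_eq_id, ← Matrix.toLin'_one, Matrix.toLin'.injective.eq_iff,
      Matrix.transpose_eq_one]
  have hmem (g : {g : Matrix.symplecticGroup (Fin n) F // g ^ 2 = 1}) :
      IsSqZeroSelfAdjoint (Matrix.toBilin' (Matrix.J (Fin n) F))
        (Matrix.toLin' (g.1 : Matrix _ _ F).transpose - 1) := by
    refine isSqZeroSelfAdjoint_sub_one_iff.2
      ⟨(mem_symplecticGroup_iff_toBilin' n F).1 g.1.2, (hmul _).2 ?_⟩
    have := congrArg Subtype.val g.2
    rwa [pow_two] at this
  refine Nat.card_congr (Equiv.ofBijective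
    (fun g => (⟨_, hmem g⟩ : {N | IsSqZeroSelfAdjoint (Matrix.toBilin' (Matrix.J (Fin n) F)) N}))
    ⟨fun g g' h => ?_, fun ⟨N, hN⟩ => ?_⟩)
  · have h := congrArg Subtype.val h
    exact Subtype.ext <| Subtype.ext <| Matrix.transpose_injective <|
      Matrix.toLin'.injective <| sub_left_injective h
  · obtain ⟨A, hA⟩ : ∃ A : Matrix (Fin n ⊕ Fin n) (Fin n ⊕ Fin n) F,
        Matrix.toLin' A.transpose - 1 = N :=
      ⟨(LinearMap.toMatrix' (N + 1)).transpose, by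
        rw [Matrix.transpose_transpose, Matrix.toLin'_toMatrix', add_sub_cancel_right]⟩
    subst hA
    obtain ⟨h1, h2⟩ := isSqZeroSelfAdjoint_sub_one_iff.1 hN
    refine ⟨⟨⟨A, (mem_symplecticGroup_iff_toBilin' n F).2 h1⟩, Subtype.ext ?_⟩, rfl⟩
    rw [pow_two]
    exact (hmul A).1 h2

end SymplecticGroup

/-! ### The limit -/

theorem mainTheorem6 (F : Type*) [Field F] [Fintype F] (q : ℕ)
    (hq : Fintype.card F = q) (hq_even : Even q) :
    Multipliable (fun i : ℕ => 1 + 1 / (q : ℝ) ^ (2 * (i + 1))) ∧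
    Filter.Tendsto
      (fun n : ℕ => (symplecticInvolutionCount n F : ℝ) / (q : ℝ) ^ (n ^ 2 + n))
      Filter.atTop
      (nhds (∏' i : ℕ, (1 + 1 / (q : ℝ) ^ (2 * (i + 1))))) := by
  have hchar : CharP F 2 := by
    rw [← FiniteField.even_card_iff_char_two.2 (by rw [hq]; exact Nat.even_iff.1 hq_even)]
    infer_instance
  have hq2 : (2 : ℝ) ≤ q := by
    rw [← hq]
    exact_mod_cast Fintype.one_lt_card (α := F)
  have hq0 : (q : ℝ) ≠ 0 := by linarith
  have hQ4 : (4 : ℝ) ≤ (q : ℝ) ^ 2 := by nlinarith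
  have hcard : ((q : ℝ) ^ 2) = (Nat.card F : ℝ) ^ 2 := by rw [Nat.card_eq_fintype_card, hq]
  have hmult : Multipliable (fun i : ℕ => 1 + 1 / (q : ℝ) ^ (2 * (i + 1))) := by
    apply Real.multipliable_one_add_of_summable
    have h := (summable_geometric_of_lt_one (r := 1 / (q : ℝ) ^ 2) (by positivity)
      (by rw [div_lt_one (by positivity)]; linarith)).comp_injective (add_left_injective 1)
    refine h.congr fun i => ?_
    simp [pow_mul]
  refine ⟨hmult, ?_⟩
  have hprod := hmult.hasProd.tendsto_prod_nat
  have heq := tendsto_nhds_unique hprod ((tendsto_prod_one_add_inv_pow hQ4).congr fun n =>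
    Finset.prod_congr rfl fun i _ => by rw [pow_mul])
  rw [heq]
  refine (tendsto_qPoch_mul_sum hQ4).congr fun n => ?_
  rw [symplecticInvolutionCount_eq_sqZeroCount, sqZeroCount_formula hcard hQ4 n
    (isSymplecticForm_J n F) (by simp [two_mul]), qFact_eq _ hq0, mul_assoc,
    mul_div_cancel_left₀ _ (pow_ne_zero _ hq0)]
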